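/- Let $n\ge 1$. Let $B_{2,n}$ be the mixed braid group on two fixed strands and $n$ moving strands, i.e. the group with generators $\mathcal T,\tau,\sigma_1,\dots,\sigma_{n-1}$ and defining relations \[ \begin{aligned} &\sigma_k\sigma_j=\sigma_j\sigma_k\ \ (|k-j|>1),\qquad \sigma_k\sigma_{k+1}\sigma_k=\sigma_{k+1}\sigma_k\sigma_{k+1}\ \ (1\le k\le n-2),\\ &\mathcal T\sigma_k=\sigma_k\mathcal T,\quad \tau\sigma_k=\sigma_k\tau\ \ (k\ge 2),\\ &\mathcal T\sigma_1\mathcal T\sigma_1=\sigma_1\mathcal T\sigma_1\mathcal T,\qquad \tau\sigma_1\tau\sigma_1=\sigma_1\tau\sigma_1\tau,\qquad \tau(\sigma_1\mathcal T\sigma_1)=(\sigma_1\mathcal T\sigma_1)\tau \end{aligned} \] (relations involving a $\sigma_k$ with $k>n-1$ are absent). For $1\le i\le n$ put $\mathcal T_i=\sigma_{i-1}\cdots\sigma_1\,\mathcal T\,\sigma_1\cdots\sigma_{i-1}$ and $\tau_i=\sigma_{i-1}\cdots\sigma_1\,\tau\,\sigma_1\cdots\sigma_{i-1}$; the elements $\mathcal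 T_i^{\pm1},\tau_i^{\pm1}$ are called loopings of index $i$. Let $\mathrm H_{2,n}(q)$ be the quotient of the group algebra $\mathbb Z[q^{\pm1}]B_{2,n}$ ($q$ a variable) by the two-sided ideal generated by $\sigma_i^2-(q-1)\sigma_i-q\cdot 1$, $1\le i\le n-1$, and let $g_i$ be the image of $\sigma_i$; images of loopings are denoted by the same symbols. (Part A) Let $k\ge1$, let $w\in B_{2,n}$ be a product of $k$ loopings, and let $m$ and $M$ be the minimum and maximum index of the loopings in this product. Then in $\mathrm H_{2,n}(q)$ the element $w$ is a finite $\mathbb Z[q^{\pm1}]$-linear combination of terms $w'G$ such that (i) each $w'$ is the image of a product of exactly $k$ loopings; (ii) the index of each looping in $w'$ lies in $[m,M]$; (iii) the indices of the loopings in $w'$ increase (weakly) from left to right; (iv) each $G$ is a finite product of elements $g_i^{\pm1}$ with $i\in[m,M-1]$ if $m<M$, and $G=1$ if $m=M$. (Part B) Every element of $\mathrm H_{2,n}(q)$ is a finite $\mathbb Z[q^{\pm1}]$-linear combination of products $\Pi_1\Pi_2\cdots\Pi_nG$, where each $\Pi_i$ is a finite (possibly empty) product of loopings of index $i$ only, and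 $G$ is a finite (possibly empty) product of the braiding generators $g_1,\dots,g_{n-1}$. That is, the set $\Lambda_n$ of all such products spans $\mathrm H_{2,n}(q)$ as a $\mathbb Z[q^{\pm1}]$-module. -/

import Mathlib

noncomputable section

namespace MixedBraid

/-- The two kinds of looping generators: `T` is the generator `𝒯` (looping around the fixed
strand `I`) and `tau` is the generator `τ` (looping around the fixed strand `II`). -/
inductive LoopKind
  | T
  | tau

/-- The generators of the mixed braid group on `n` moving strands. All indices are shifted to
start at `0`: the moving strands are indexed by `Fin n`, and `sigma i` is the crossing of the
moving strands `i` and `i + 1`, so `i` runs through `Fin (n - 1)`. -/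
inductive Gen (n : ℕ)
  | loop (κ : LoopKind)
  | sigma (i : Fin (n - 1))

/-- The free generator `𝒯` or `τ`. -/
def fLoop (n : ℕ) (κ : LoopKind) : FreeGroup (Gen n) := FreeGroup.of (Gen.loop κ)

/-- The free generator `σ_i`. -/
def fSigma {n : ℕ} (i : Fin (n - 1)) : FreeGroup (Gen n) := FreeGroup.of (Gen.sigma i)

/-- The defining relations `a = b` of the mixed braid group `B_{2,n}`. The usual index `k` (from `1`)
of `σ_k` is `(k : ℕ) + 1` here. -/
inductive BraidRel (n : ℕ) : FreeGroup (Gen n) → FreeGroup (Gen n) → Prop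
  /-- `σ_k σ_j = σ_j σ_k` for `|k - j| > 1`. -/
  | comm (k j : Fin (n - 1)) (h : (k : ℕ) + 1 < j ∨ (j : ℕ) + 1 < k) :
      BraidRel n (fSigma k * fSigma j) (fSigma j * fSigma k)
  /-- `σ_k σ_{k+1} σ_k = σ_{k+1} σ_k σ_{k+1}`. -/
  | braid (k j : Fin (n - 1)) (h : (j : ℕ) = k + 1) :
      BraidRel n (fSigma k * fSigma j * fSigma k) (fSigma j * fSigma k * fSigma j)
  /-- `𝒯 σ_k = σ_k 𝒯` and `τ σ_k = σ_k τ` for every `σ_k` other than the first one. -/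
  | loop_comm (κ : LoopKind) (k : Fin (n - 1)) (h : 0 < (k : ℕ)) :
      BraidRel n (fLoop n κ * fSigma k) (fSigma k * fLoop n κ)
  /-- `𝒯 σ_1 𝒯 σ_1 = σ_1 𝒯 σ_1 𝒯` and `τ σ_1 τ σ_1 = σ_1 τ σ_1 τ`. -/
  | loop_sigma (κ : LoopKind) (s : Fin (n - 1)) (h : (s : ℕ) = 0) :
      BraidRel n (fLoop n κ * fSigma s * fLoop n κ * fSigma s)
        (fSigma s * fLoop n κ * fSigma s * fLoop n κ)
  /-- `τ (σ_1 𝒯 σ_1) = (σ_1 𝒯 σ_1) τ`. -/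
  | mixed (s : Fin (n - 1)) (h : (s : ℕ) = 0) :
      BraidRel n (fLoop n .tau * (fSigma s * fLoop n .T * fSigma s))
        ((fSigma s * fLoop n .T * fSigma s) * fLoop n .tau)

/-- The mixed braid group `B_{2,n}` on two fixed and `n ≥ 1` moving strands. -/
abbrev B2 (n : ℕ) : Type :=
  PresentedGroup {r : FreeGroup (Gen n) | ∃ a b, BraidRel n a b ∧ r = a * b⁻¹}

/-- The generator `𝒯` or `τ` of `B_{2,n}`. -/
def loopGen (n : ℕ) (κ : LoopKind) : B2 n := PresentedGroup.of (Gen.loop κ)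

/-- The generator `σ_i` of `B_{2,n}`. -/
def sigma {n : ℕ} (i : Fin (n - 1)) : B2 n := PresentedGroup.of (Gen.sigma i)

/-- `loopAux κ i` is `σ_{i-1} ⋯ σ_0 x σ_0 ⋯ σ_{i-1}` (indices from `0`), with `x` the generator
`𝒯` or `τ` according to `κ`. -/
def loopAux {n : ℕ} (κ : LoopKind) : (i : ℕ) → i < n → B2 n
  | 0, _ => loopGen n κ
  | i + 1, h =>
      sigma ⟨i, by omega⟩ * loopAux κ i (by omega) * sigma ⟨i, by omega⟩

/-- A looping `𝒯_i^{±1}` or `τ_i^{±1}`, as a letter: its kind, its index, and its exponent. -/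
structure Looping (n : ℕ) where
  kind : LoopKind
  idx : Fin n
  exp : ℤˣ

/-- The element of `B_{2,n}` given by a looping letter. -/
def Looping.toBraid {n : ℕ} (l : Looping n) : B2 n :=
  loopAux l.kind l.idx l.idx.isLt ^ (l.exp : ℤ)

/-- A braiding letter `σ_i^{±1}`: its index and its exponent. -/
structure Crossing (n : ℕ) where
  idx : Fin (n - 1)
  exp : ℤˣ

/-- The element of `B_{2,n}` given by a braiding letter. -/
def Crossing.toBraid {n : ℕ} (c : Crossing n) : B2 n := sigma c.idx ^ (c.exp : ℤ)

/-- The ring `ℤ[q, q⁻¹]`. -/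
abbrev Coeff : Type := LaurentPolynomial ℤ

/-- The variable `q`. -/
def q : Coeff := LaurentPolynomial.T 1

/-- The quadratic relations `σ_i² = (q - 1) σ_i + q · 1` in the group algebra of `B_{2,n}`. -/
inductive QuadRel (n : ℕ) : MonoidAlgebra Coeff (B2 n) → MonoidAlgebra Coeff (B2 n) → Prop
  | quad (i : Fin (n - 1)) :
      QuadRel n (MonoidAlgebra.of Coeff (B2 n) (sigma i) ^ 2)
        ((q - 1) • MonoidAlgebra.of Coeff (B2 n) (sigma i) + q • 1)

/-- The mixed Hecke algebra `H_{2,n}(q)`: the quotient of the group algebra `ℤ[q, q⁻¹] B_{2,n}`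
by the two-sided ideal generated by the quadratic relations. -/
abbrev H2 (n : ℕ) : Type := RingQuot (QuadRel n)

/-- The image in `H_{2,n}(q)` of a braid of `B_{2,n}`. -/
def toH (n : ℕ) : B2 n →* H2 n :=
  ((RingQuot.mkAlgHom Coeff (QuadRel n) : MonoidAlgebra Coeff (B2 n) →ₐ[Coeff] H2 n) :
    MonoidAlgebra Coeff (B2 n) →* H2 n).comp (MonoidAlgebra.of Coeff (B2 n))

/-- The image in `H_{2,n}(q)` of the product of a word in the loopings. -/
def loopWord {n : ℕ} (w : List (Looping n)) : H2 n := toH n (w.map Looping.toBraid).prod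

/-- The image in `H_{2,n}(q)` of the product of a word in the `σ_i^{±1}`, i.e. the product of the
corresponding `g_i^{±1}`. -/
def crossingWord {n : ℕ} (G : List (Crossing n)) : H2 n := toH n (G.map Crossing.toBraid).prod

/-- The braiding generator `g_i` of `H_{2,n}(q)`. -/
def g {n : ℕ} (i : Fin (n - 1)) : H2 n := toH n (sigma i)

/-- The products `w' G`, where `w'` is a product of `k` loopings with indices in `[m, M]` that
(weakly) increase from left to right, and `G` is a product of `g_i^{±1}` with `i ∈ [m, M - 1]`
(so `G = 1` if `m = M`). -/
def orderedTerms {n : ℕ} (k : ℕ) (m M : Fin n) : Set (H2 n) :=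
  {x | ∃ (w' : List (Looping n)) (G : List (Crossing n)),
    w'.length = k ∧
    (∀ l ∈ w', m ≤ l.idx ∧ l.idx ≤ M) ∧
    w'.Pairwise (fun l l' => l.idx ≤ l'.idx) ∧
    (∀ c ∈ G, (m : ℕ) ≤ c.idx ∧ (c.idx : ℕ) < M) ∧
    x = loopWord w' * crossingWord G}

/-- The set `Λ_n` of products `Π_1 Π_2 ⋯ Π_n G`, with `Π_i` a finite product of loopings of index
`i` and `G` a finite product of braiding generators `g_i`. -/
def Lambda (n : ℕ) : Set (H2 n) :=
  {x | ∃ (P : Fin n → List (Looping n)) (G : List (Fin (n - 1))),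
    (∀ i, ∀ l ∈ P i, l.idx = i) ∧
    x = (List.ofFn fun i => loopWord (P i)).prod * (G.map g).prod}

end MixedBraid

end

/-! Bring the loopings of lowest index `m` to the front of a word, then recurse on the loopings with
index in `[m+1, M]`. Three facts drive this.

Crossings move to the right past loopings without changing the number of loopings
(`crossSpan_mul_loopSpan`), so they can be collected at the end. Every looping of index above `m` is
a looping of index `m+1` multiplied on both sides by crossings of index above `m`
(`loopSpan_le_conj`), and these crossings commute with loopings of index `m`. So only the exchange
of indices `m+1` and `m` matters. There, all pairs commute in the braid group except `τ_{m+1}` with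
`𝒯_m`.

For that pair the quadratic relation is used. With equal exponents it gives words starting at index
`m`. With opposite exponents it also leaves a term `τ_{m+1}^ε 𝒯_{m+1}^{-ε} g_m^ε` with no letter of
index `m` (`loopSpan_exchange`). The obstruction is harmless, since the pair `τ_{m+1}^ε
𝒯_{m+1}^{-ε}` can itself be moved past index `m` (`mixedSpan_mul_le`). The bookkeeping is the purely
algebraic `sortedWords_absorb`, where `E`, `P'`, `F` are the spans of loopings of index `m`, in
`[m+1, M]`, and equal to `m+1`; `H` and `H'` are spans of crossing words and `B` is the span of the
obstructions.

For Part B, the words "loopings, then crossings" span a left ideal containing `1`; Part A sorts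
them, and `g_i⁻¹` is a combination of `1` and `g_i`. -/

/-! ### Sorting words, abstractly -/

/-- If words in `E ⊔ P'` can be exchanged modulo `E`-leading words and modulo a submodule `B` that
moves past `E`, then they lie in the span `R` of the words in which all letters of `E` come first. -/
theorem sortedWords_absorb {K A : Type*} [CommSemiring K] [Semiring A] [Algebra K A]
    (E P' P H' H F B : Submodule K A) (R : ℕ → Submodule K A)
    (hR0 : R 0 = H) (hR : ∀ k, R (k + 1) = E * R k ⊔ P' ^ (k + 1) * H)
    (hP : P = E ⊔ P') (hHH : H * H ≤ H) (hH'H : H' ≤ H)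
    (hHP : H * P ≤ P * H) (hHP' : H' * P' ≤ P' * H') (hHE : H' * E ≤ E * H')
    (hP'F : P' ≤ H' * F * H') (hF : F ≤ P') (hFE : F * E ≤ E * P * H ⊔ B * H)
    (hB : B ≤ P' * P') (hBE : B * E ≤ E * P * P * H) (k : ℕ) :
    P ^ k * H ≤ R k := by
  have push : ∀ k, H * (P ^ k * H) ≤ P ^ k * H := by
    intro k
    induction k with
    | zero => simpa using hHH
    | succ k ih =>
      calc H * (P ^ (k + 1) * H) = (H * P) * (P ^ k * H) := by simp only [pow_succ', mul_assoc]
        _ ≤ (P * H) * (P ^ k * H) := mul_le_mul' hHP le_rfl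
        _ = P * (H * (P ^ k * H)) := by simp only [mul_assoc]
        _ ≤ P * (P ^ k * H) := mul_le_mul' le_rfl ih
        _ = _ := by simp only [pow_succ', mul_assoc]
  have push' : ∀ k, H' * P' ^ k ≤ P' ^ k * H' := by
    intro k
    induction k with
    | zero => simp
    | succ k ih =>
      calc H' * P' ^ (k + 1) = (H' * P') * P' ^ k := by simp only [pow_succ', mul_assoc]
        _ ≤ (P' * H') * P' ^ k := mul_le_mul' hHP' le_rfl
        _ = P' * (H' * P' ^ k) := by simp only [mul_assoc]
        _ ≤ P' * (P' ^ k * H') := mul_le_mul' le_rfl ih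
        _ = _ := by simp only [pow_succ', mul_assoc]
  have hE : E ≤ P := hP ▸ le_sup_left
  have hP'P : P' ≤ P := hP ▸ le_sup_right
  have RW : ∀ k, R k ≤ P ^ k * H := by
    intro k
    induction k with
    | zero => simp [hR0]
    | succ k ih =>
      rw [hR, pow_succ' P, mul_assoc]
      refine sup_le (mul_le_mul' hE ih) ?_
      rw [← mul_assoc, ← pow_succ']
      exact mul_le_mul' (pow_le_pow_left' hP'P _) le_rfl
  have ER : ∀ k, E * R k ≤ R (k + 1) := fun k => hR k ▸ le_sup_left
  have PR : ∀ k, P' ^ k * H ≤ R k := by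
    rintro (_ | k)
    · simp [hR0]
    · exact hR k ▸ le_sup_right
  induction k using Nat.strong_induction_on with
  | _ k ih =>
  rcases k with _ | k
  · simp [hR0]
  have EW : E * (P ^ k * H) ≤ R (k + 1) :=
    (mul_le_mul' le_rfl (ih k (by omega))).trans (ER k)
  have FW : F * (P ^ k * H) ≤ R (k + 1) := by
    refine (mul_le_mul' le_rfl (ih k (by omega))).trans ?_
    rcases k with _ | j
    · rw [hR0]
      refine le_trans (mul_le_mul' hF le_rfl) ?_
      simpa using PR 1
    rw [hR j, Submodule.mul_sup]
    refine sup_le ?_ ?_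
    · have EPHR : E * P * H * R j ≤ R (j + 1 + 1) := by
        refine le_trans ?_ EW
        calc E * P * H * R j ≤ E * P * H * (P ^ j * H) := mul_le_mul' le_rfl (RW j)
          _ = E * P * (H * (P ^ j * H)) := by simp only [mul_assoc]
          _ ≤ E * P * (P ^ j * H) := mul_le_mul' le_rfl (push j)
          _ = _ := by simp only [pow_succ', mul_assoc]
      rw [← mul_assoc]
      refine (mul_le_mul' hFE le_rfl).trans ?_
      rw [Submodule.sup_mul]
      refine sup_le EPHR ?_
      -- Absorbing `H` into `R j` needs the claim at length `j`, two below the current length; hence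
      -- strong induction.
      have h1 : B * H * R j ≤ B * R j := by
        rw [mul_assoc]
        refine mul_le_mul' le_rfl ?_
        exact (mul_le_mul' le_rfl (RW j)).trans ((push j).trans (ih j (by omega)))
      have BP : ∀ i, B * (P' ^ i * H) ≤ R (i + 1 + 1) := by
        intro i
        refine le_trans ?_ (PR _)
        calc B * (P' ^ i * H) ≤ P' * P' * (P' ^ i * H) := mul_le_mul' hB le_rfl
          _ = _ := by simp only [pow_succ', mul_assoc]
      refine h1.trans ?_
      rcases j with _ | i
      · simpa [hR0] using BP 0
      rw [hR i, Submodule.mul_sup]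
      refine sup_le ?_ (BP _)
      refine le_trans ?_ EW
      calc B * (E * R i) = B * E * R i := by simp only [mul_assoc]
        _ ≤ E * P * P * H * (P ^ i * H) := mul_le_mul' hBE (RW i)
        _ = E * P * P * (H * (P ^ i * H)) := by simp only [mul_assoc]
        _ ≤ E * P * P * (P ^ i * H) := mul_le_mul' le_rfl (push i)
        _ = _ := by simp only [pow_succ', mul_assoc]
    · refine le_trans ?_ (PR (j + 1 + 1))
      rw [← mul_assoc, pow_succ' P' (j + 1)]
      exact mul_le_mul' (mul_le_mul' hF le_rfl) le_rfl
  have HR : H' * R (k + 1) ≤ R (k + 1) := by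
    nth_rw 1 [hR k]
    rw [Submodule.mul_sup]
    refine sup_le ?_ ?_
    · refine le_trans ?_ EW
      calc H' * (E * R k) = H' * E * R k := by simp only [mul_assoc]
        _ ≤ E * H * (P ^ k * H) :=
          mul_le_mul' (hHE.trans (mul_le_mul' le_rfl hH'H)) (RW k)
        _ = E * (H * (P ^ k * H)) := by simp only [mul_assoc]
        _ ≤ _ := mul_le_mul' le_rfl (push k)
    · refine le_trans ?_ (PR (k + 1))
      rw [← mul_assoc]
      refine (mul_le_mul' (push' _) le_rfl).trans ?_
      rw [mul_assoc]
      exact mul_le_mul' le_rfl ((mul_le_mul' hH'H le_rfl).trans hHH)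
  rw [pow_succ', mul_assoc]
  nth_rw 1 [hP]
  rw [Submodule.sup_mul]
  refine sup_le EW ?_
  -- The right `H'` is absorbed by the word, `F` is handled by `FW`, and the left `H'` preserves `R
  -- (k + 1)` because it passes both `E` and `P'`.
  calc P' * (P ^ k * H) ≤ H' * F * H' * (P ^ k * H) := mul_le_mul' hP'F le_rfl
    _ = H' * (F * (H' * (P ^ k * H))) := by simp only [mul_assoc]
    _ ≤ H' * (F * (P ^ k * H)) := by
      refine mul_le_mul' le_rfl (mul_le_mul' le_rfl ?_)
      exact (mul_le_mul' hH'H le_rfl).trans (push k)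
    _ ≤ H' * R (k + 1) := mul_le_mul' le_rfl FW
    _ ≤ _ := HR

/-! ### Loopings and crossings in the braid group -/

noncomputable section
namespace MixedBraid

theorem braid_exchange {G : Type*} [Group G] {r s a b : G} (hrs : r * s * r = s * r * s)
    (ha : Commute a s) (hb : Commute b s) (h : a * r * b * r = r * b * r * a) :
    (r * a * r) * s * (r * b * r) * s = s * (r * b * r) * s * (r * a * r) := by
  have ha' := ha.eq
  have hb' := hb.eq
  calc (r * a * r) * s * (r * b * r) * s = r * a * (r * s * r) * b * r * s := by group
    _ = r * (a * s) * r * (s * b) * r * s := by rw [hrs]; group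
    _ = r * s * (a * r * b) * (s * r * s) := by rw [ha', ← hb']; group
    _ = r * s * (a * r * b * r) * s * r := by rw [← hrs]; group
    _ = (r * s * r) * b * r * (a * s) * r := by rw [h]; group
    _ = s * r * (s * b) * r * s * a * r := by rw [hrs, ha']; group
    _ = s * r * b * (s * r * s) * a * r := by rw [← hb']; group
    _ = _ := by rw [← hrs]; group

theorem mk_eq_of_rel {n : ℕ} {a b : FreeGroup (Gen n)} (h : BraidRel n a b) :
    (PresentedGroup.mk {r : FreeGroup (Gen n) | ∃ a b, BraidRel n a b ∧ r = a * b⁻¹}) a =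
      PresentedGroup.mk _ b := by
  rw [← mul_inv_eq_one, ← map_inv, ← map_mul]
  exact PresentedGroup.one_of_mem ⟨a, b, h, rfl⟩

theorem mk_fSigma {n : ℕ} (i : Fin (n - 1)) :
    (PresentedGroup.mk {r : FreeGroup (Gen n) | ∃ a b, BraidRel n a b ∧ r = a * b⁻¹})
      (fSigma i) = sigma i := rfl

theorem mk_fLoop {n : ℕ} (κ : LoopKind) :
    (PresentedGroup.mk {r : FreeGroup (Gen n) | ∃ a b, BraidRel n a b ∧ r = a * b⁻¹})
      (fLoop n κ) = loopGen n κ := rfl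

variable {n : ℕ}

theorem sigma_comm (k j : Fin (n - 1)) (h : (k : ℕ) + 1 < j) : Commute (sigma k) (sigma j) := by
  have := mk_eq_of_rel (BraidRel.comm k j (.inl h))
  change _ * _ = _ * _
  simpa only [map_mul, mk_fSigma] using this

theorem sigma_braid (k j : Fin (n - 1)) (h : (j : ℕ) = k + 1) :
    sigma k * sigma j * sigma k = sigma j * sigma k * sigma j := by
  have := mk_eq_of_rel (BraidRel.braid k j h)
  simpa only [map_mul, mk_fSigma] using this

theorem loopAux_comm_of_lt (κ : LoopKind) (i : ℕ) (hi : i < n) (j : Fin (n - 1)) (h : i < j) :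
    Commute (loopAux κ i hi) (sigma j) := by
  induction i with
  | zero =>
    have := mk_eq_of_rel (BraidRel.loop_comm κ j h)
    change _ * _ = _ * _
    simpa only [map_mul, mk_fSigma, mk_fLoop, loopAux] using this
  | succ i ih =>
    have h1 : Commute (sigma ⟨i, by omega⟩) (sigma j) := sigma_comm _ _ h
    exact (h1.mul_left (ih (by omega) (by omega))).mul_left h1

/-- The critical case is `i = j + 2`: the braid relation turns `σ_j` into `σ_{j+1}`, which passes
the inner looping of index `j`, and a second braid relation turns it back. -/
theorem loopAux_comm_of_gt (κ : LoopKind) (i : ℕ) (hi : i < n) (j : Fin (n - 1))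
    (h : (j : ℕ) + 1 < i) : Commute (loopAux κ i hi) (sigma j) := by
  induction i with
  | zero => omega
  | succ i ih =>
    by_cases hj : (j : ℕ) + 1 < i
    · have h1 : Commute (sigma ⟨i, by omega⟩) (sigma j) := (sigma_comm _ _ hj).symm
      exact (h1.mul_left (ih (by omega) hj)).mul_left h1
    · obtain ⟨j, hj'⟩ := j
      obtain rfl : i = j + 1 := by simp at *; omega
      have hb := sigma_braid (n := n) ⟨j, hj'⟩ ⟨j + 1, by omega⟩ rfl
      have hc := (loopAux_comm_of_lt κ j (by omega) (⟨j + 1, by omega⟩ : Fin (n - 1))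
        (by simp)).eq
      change _ * _ = _ * _
      simp only [loopAux]
      generalize loopAux κ j _ = x at *
      generalize sigma (⟨j + 1, _⟩ : Fin (n - 1)) = s at *
      generalize sigma (⟨j, _⟩ : Fin (n - 1)) = r at *
      calc s * (r * x * r) * s * r = s * r * x * (r * s * r) := by group
        _ = s * r * (x * s) * r * s := by rw [hb]; group
        _ = (s * r * s) * x * r * s := by rw [hc]; group
        _ = _ := by rw [← hb]; group

/-- The pairs of kinds whose loopings of adjacent indices commute. -/
def Compatible (κ κ' : LoopKind) : Prop := κ = κ' ∨ (κ = .tau ∧ κ' = .T)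

/-- The base case is a defining relation; `braid_exchange` transports it from one index to the next.
-/
theorem loopAux_exchange {κ κ' : LoopKind} (hκ : Compatible κ κ') (i : ℕ) (hi : i < n - 1) :
    loopAux κ i (by omega) * sigma ⟨i, hi⟩ * loopAux κ' i (by omega) * sigma ⟨i, hi⟩ =
      sigma ⟨i, hi⟩ * loopAux κ' i (by omega) * sigma ⟨i, hi⟩ * loopAux κ i (by omega) := by
  induction i with
  | zero =>
    rcases hκ with rfl | ⟨rfl, rfl⟩
    · have := mk_eq_of_rel (BraidRel.loop_sigma κ (⟨0, hi⟩ : Fin (n - 1)) rfl)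
      simpa only [map_mul, mk_fSigma, mk_fLoop, loopAux] using this
    · have := mk_eq_of_rel (BraidRel.mixed (⟨0, hi⟩ : Fin (n - 1)) rfl)
      simpa only [map_mul, mk_fSigma, mk_fLoop, loopAux, mul_assoc] using this
  | succ i ih =>
    exact braid_exchange (sigma_braid _ _ rfl) (loopAux_comm_of_lt _ _ _ _ (by simp))
      (loopAux_comm_of_lt _ _ _ _ (by simp)) (ih (by omega))

/-- The looping of kind `κ`, index `i` and exponent `ε`. -/
def looping (κ : LoopKind) (i : ℕ) (h : i < n) (ε : ℤˣ) : B2 n := loopAux κ i h ^ (ε : ℤ)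

/-- The braiding letter of index `i` and exponent `ε`. -/
def crossing (i : ℕ) (h : i < n - 1) (ε : ℤˣ) : B2 n := sigma ⟨i, h⟩ ^ (ε : ℤ)

theorem looping_neg (κ : LoopKind) (i : ℕ) (h : i < n) (ε : ℤˣ) :
    looping κ i h (-ε) = (looping κ i h ε)⁻¹ := by simp [looping]

theorem crossing_neg (i : ℕ) (h : i < n - 1) (ε : ℤˣ) :
    crossing i h (-ε) = (crossing i h ε)⁻¹ := by simp [crossing]

theorem looping_succ (κ : LoopKind) (i : ℕ) (h : i < n - 1) (ε : ℤˣ) :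
    looping κ (i + 1) (by omega) ε =
      crossing i h ε * looping κ i (by omega) ε * crossing i h ε := by
  rcases Int.units_eq_one_or ε with rfl | rfl <;> simp [looping, crossing, loopAux, mul_assoc]

theorem looping_comm_crossing (κ : LoopKind) (i j : ℕ) (hi : i < n) (hj : j < n - 1)
    (h : i < j ∨ j + 1 < i) (ε δ : ℤˣ) : Commute (looping κ i hi ε) (crossing j hj δ) := by
  refine Commute.zpow_zpow ?_ _ _
  rcases h with h | h
  · exact loopAux_comm_of_lt κ i hi ⟨j, hj⟩ h
  · exact loopAux_comm_of_gt κ i hi ⟨j, hj⟩ h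

theorem looping_comm {κ κ' : LoopKind} (hκ : Compatible κ κ') (i : ℕ) (h : i < n - 1)
    (ε δ : ℤˣ) :
    Commute (looping κ i (by omega) ε) (looping κ' (i + 1) (by omega) δ : B2 n) := by
  refine Commute.zpow_zpow ?_ _ _
  have := loopAux_exchange hκ i h
  change _ * _ = _ * _
  simpa only [loopAux, mul_assoc] using this

/-! ### The quadratic relation -/

theorem q_mul_inv : q * LaurentPolynomial.T (-1) = 1 := by
  rw [q, ← LaurentPolynomial.T_add]; simp

theorem g_sq (i : Fin (n - 1)) : g i * g i = (q - 1) • g i + q • (1 : H2 n) := by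
  have := RingQuot.mkAlgHom_rel Coeff (QuadRel.quad i)
  rw [map_pow, map_add, map_smul, map_smul, map_one, sq] at this
  exact this

/-- Quantifying over the context `a`, `b` allows rewriting inside a braid word, and treating both
signs at once makes later arguments uniform in `ε`. -/
theorem toH_quad (i : ℕ) (h : i < n - 1) (ε : ℤˣ) : ∃ c d : Coeff, ∀ a b : B2 n,
    toH n (a * crossing i h ε * b) =
      c • toH n (a * b) + d • toH n (a * (crossing i h ε)⁻¹ * b) := by
  have key : ∀ a b : B2 n, toH n (a * sigma ⟨i, h⟩ * b) =
      (q - 1) • toH n (a * b) + q • toH n (a * (sigma ⟨i, h⟩)⁻¹ * b) := by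
    intro a b
    have h1 := congrArg (fun x => toH n a * x * toH n ((sigma ⟨i, h⟩)⁻¹ * b))
      (g_sq (n := n) ⟨i, h⟩)
    simp only [g, mul_add, add_mul, mul_smul_comm, smul_mul_assoc, mul_one, ← map_mul] at h1
    simpa [mul_assoc] using h1
  rcases Int.units_eq_one_or ε with rfl | rfl
  · exact ⟨q - 1, q, by simpa [crossing] using key⟩
  · refine ⟨-(LaurentPolynomial.T (-1) * (q - 1)), LaurentPolynomial.T (-1), fun a b => ?_⟩
    have h2 : LaurentPolynomial.T (-1) * q = 1 := by rw [mul_comm]; exact q_mul_inv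
    simp [crossing, key, smul_smul, h2, smul_add]
    module

theorem toH_sq (i : ℕ) (h : i < n - 1) (ε : ℤˣ) : ∃ c d : Coeff, ∀ a b : B2 n,
    toH n (a * crossing i h ε * crossing i h ε * b) =
      c • toH n (a * crossing i h ε * b) + d • toH n (a * b) := by
  obtain ⟨c, d, hcd⟩ := toH_quad i h ε
  refine ⟨c, d, fun a b => ?_⟩
  rw [hcd (a * crossing i h ε) b]
  simp

/-! ### Moving crossings past loopings -/

/-- The span of the loopings with index in `[m, M]`. -/
def loopSpan (n m M : ℕ) : Submodule Coeff (H2 n) :=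
  Submodule.span Coeff {x | ∃ (κ : LoopKind) (i : ℕ) (h : i < n) (ε : ℤˣ),
    m ≤ i ∧ i ≤ M ∧ x = toH n (looping κ i h ε)}

/-- The span of the products of braiding letters with index in `[m, M - 1]`. -/
def crossSpan (n m M : ℕ) : Submodule Coeff (H2 n) :=
  Submodule.span Coeff {x | ∃ G : List (Crossing n),
    (∀ c ∈ G, m ≤ (c.idx : ℕ) ∧ (c.idx : ℕ) < M) ∧ x = crossingWord G}

theorem looping_mem {m M i : ℕ} (κ : LoopKind) (h : i < n) (ε : ℤˣ) (h1 : m ≤ i) (h2 : i ≤ M) :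
    toH n (looping κ i h ε) ∈ loopSpan n m M :=
  Submodule.subset_span ⟨κ, i, h, ε, h1, h2, rfl⟩

theorem crossing_mem {m M i : ℕ} (h : i < n - 1) (ε : ℤˣ) (h1 : m ≤ i) (h2 : i < M) :
    toH n (crossing i h ε) ∈ crossSpan n m M :=
  Submodule.subset_span ⟨[⟨⟨i, h⟩, ε⟩], by simp [h1, h2],
    by simp [crossingWord, crossing, Crossing.toBraid]⟩

theorem crossing_inv_mem {m M i : ℕ} (h : i < n - 1) (ε : ℤˣ) (h1 : m ≤ i) (h2 : i < M) :
    toH n (crossing i h ε)⁻¹ ∈ crossSpan n m M := by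
  rw [← crossing_neg]; exact crossing_mem h _ h1 h2

theorem one_mem_crossSpan (m M : ℕ) : (1 : H2 n) ∈ crossSpan n m M :=
  Submodule.subset_span ⟨[], by simp, by simp [crossingWord]⟩

theorem one_le_crossSpan (m M : ℕ) : 1 ≤ crossSpan n m M :=
  Submodule.one_le.2 (one_mem_crossSpan m M)

theorem crossSpan_mul_self (m M : ℕ) : crossSpan n m M * crossSpan n m M ≤ crossSpan n m M := by
  rw [crossSpan, Submodule.span_mul_span]
  refine Submodule.span_mono ?_
  rintro _ ⟨_, ⟨G, hG, rfl⟩, _, ⟨G', hG', rfl⟩, rfl⟩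
  refine ⟨G ++ G', ?_, by simp [crossingWord]⟩
  intro c hc
  rcases List.mem_append.1 hc with hc | hc
  exacts [hG c hc, hG' c hc]

theorem mul_mem_crossSpan {m M : ℕ} {x y : H2 n} (hx : x ∈ crossSpan n m M)
    (hy : y ∈ crossSpan n m M) : x * y ∈ crossSpan n m M :=
  crossSpan_mul_self m M (Submodule.mul_mem_mul hx hy)

theorem crossSpan_mono {m m' M : ℕ} (h : m ≤ m') : crossSpan n m' M ≤ crossSpan n m M := by
  refine Submodule.span_mono ?_
  rintro _ ⟨G, hG, rfl⟩
  exact ⟨G, fun c hc => ⟨h.trans (hG c hc).1, (hG c hc).2⟩, rfl⟩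

theorem loopSpan_mono {m m' M M' : ℕ} (h : m ≤ m') (h' : M' ≤ M) :
    loopSpan n m' M' ≤ loopSpan n m M := by
  refine Submodule.span_mono ?_
  rintro _ ⟨κ, i, hi, ε, h1, h2, rfl⟩
  exact ⟨κ, i, hi, ε, h.trans h1, h2.trans h', rfl⟩

theorem loopSpan_eq_sup {m M : ℕ} (h : m ≤ M) :
    loopSpan n m M = loopSpan n m m ⊔ loopSpan n (m + 1) M := by
  refine le_antisymm ?_ (sup_le (loopSpan_mono le_rfl h) (loopSpan_mono (by omega) le_rfl))
  refine Submodule.span_le.2 ?_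
  rintro _ ⟨κ, i, hi, ε, h1, h2, rfl⟩
  rcases h1.eq_or_lt with rfl | h1
  · exact Submodule.mem_sup_left (looping_mem κ hi ε le_rfl le_rfl)
  · exact Submodule.mem_sup_right (looping_mem κ hi ε h1 h2)

theorem crossSpan_mul_le {m M m' M' : ℕ} (Q : Submodule Coeff (H2 n))
    (h : ∀ (j : ℕ) (hj : j < n - 1) (ε : ℤˣ), m ≤ j → j < M → ∀ y ∈ Q,
      toH n (crossing j hj ε) * y ∈ Q * crossSpan n m' M') :
    crossSpan n m M * Q ≤ Q * crossSpan n m' M' := by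
  have key : ∀ G : List (Crossing n), (∀ c ∈ G, m ≤ (c.idx : ℕ) ∧ (c.idx : ℕ) < M) →
      ∀ y ∈ Q, crossingWord G * y ∈ Q * crossSpan n m' M' := by
    intro G
    induction G with
    | nil =>
      intro _ y hy
      simpa [crossingWord] using Submodule.mul_mem_mul hy (one_mem_crossSpan m' M')
    | cons c G ih =>
      intro hG y hy
      have h1 := ih (fun c hc => hG c (List.mem_cons_of_mem _ hc)) y hy
      have h2 : crossingWord (c :: G) =
          toH n (crossing c.idx c.idx.isLt c.exp) * crossingWord G := by
        simp [crossingWord, crossing, Crossing.toBraid]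
      rw [h2, mul_assoc]
      generalize crossingWord G * y = z at h1
      have hc := hG c List.mem_cons_self
      induction h1 using Submodule.mul_induction_on' with
      | mem_mul_mem a ha b hb =>
        rw [← mul_assoc]
        refine (mul_assoc Q (crossSpan n m' M') (crossSpan n m' M')).le.trans
          (mul_le_mul' le_rfl (crossSpan_mul_self m' M'))
          (Submodule.mul_mem_mul (h _ _ _ hc.1 hc.2 a ha) hb)
      | add a _ b _ ha hb => rw [mul_add]; exact add_mem ha hb
  refine Submodule.mul_le.2 fun x hx y hy => ?_
  induction hx using Submodule.span_induction with
  | mem x hx =>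
    obtain ⟨G, hG, rfl⟩ := hx
    exact key G hG y hy
  | zero => simp
  | add a b _ _ ha hb => rw [add_mul]; exact add_mem ha hb
  | smul c a _ ha => rw [smul_mul_assoc]; exact Submodule.smul_mem _ _ ha

theorem crossSpan_mul_loopSpan (m M : ℕ) :
    crossSpan n m M * loopSpan n m M ≤ loopSpan n m M * crossSpan n m M := by
  have PH : ∀ (κ : LoopKind) (i : ℕ) (hi : i < n) (ε : ℤˣ) (v : B2 n), m ≤ i → i ≤ M →
      toH n v ∈ crossSpan n m M →
      toH n (looping κ i hi ε * v) ∈ loopSpan n m M * crossSpan n m M := by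
    intro κ i hi ε v h1 h2 hv
    rw [map_mul]
    exact Submodule.mul_mem_mul (looping_mem κ hi ε h1 h2) hv
  have same : ∀ (κ : LoopKind) (i j : ℕ) (hi : i < n) (hj : j < n - 1) (ε : ℤˣ), m ≤ i → i ≤ M →
      m ≤ j → j < M → toH n (crossing j hj ε * looping κ i hi ε) ∈
        loopSpan n m M * crossSpan n m M := by
    intro κ i j hi hj ε h1 h2 h3 h4
    rcases lt_trichotomy i j with h | rfl | h
    · rw [← (looping_comm_crossing κ i j hi hj (.inl h) ε ε).eq]
      exact PH _ _ _ _ _ h1 h2 (crossing_mem hj ε h3 h4)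
    · have : crossing i hj ε * looping κ i hi ε =
          looping κ (i + 1) (by omega) ε * (crossing i hj ε)⁻¹ := by
        rw [looping_succ κ i hj]; group
      rw [this]
      exact PH _ _ _ _ _ (by omega) (by omega) (crossing_inv_mem hj ε h3 h4)
    · by_cases h' : j + 1 < i
      · rw [← (looping_comm_crossing κ i j hi hj (.inr h') ε ε).eq]
        exact PH _ _ _ _ _ h1 h2 (crossing_mem hj ε h3 h4)
      · obtain rfl : i = j + 1 := by omega
        -- Expanding the looping of index `j + 1` exposes a square of the crossing; reducing it
        -- leaves the same looping, or the one of index `j` followed by a crossing.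
        obtain ⟨c, d, hcd⟩ := toH_sq j hj ε
        have := hcd 1 (looping κ j (by omega) ε * crossing j hj ε)
        rw [one_mul, one_mul, ← mul_assoc (crossing j hj ε) (looping κ j _ ε),
          ← looping_succ κ j hj] at this
        rw [looping_succ κ j hj, ← mul_assoc, ← mul_assoc, mul_assoc _ (looping κ j _ ε), this]
        refine add_mem (Submodule.smul_mem _ _ ?_) (Submodule.smul_mem _ _ ?_)
        · simpa using PH κ (j + 1) hi ε 1 h1 h2 (by simpa using one_mem_crossSpan m M)
        · exact PH _ _ _ _ _ h3 h4.le (crossing_mem hj ε h3 h4)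
  refine crossSpan_mul_le _ fun j hj ε h3 h4 y hy => ?_
  induction hy using Submodule.span_induction with
  | zero => simp
  | add a b _ _ ha hb => rw [mul_add]; exact add_mem ha hb
  | smul c a _ ha => rw [mul_smul_comm]; exact Submodule.smul_mem _ _ ha
  | mem y hy =>
    obtain ⟨κ, i, hi, δ, h1, h2, rfl⟩ := hy
    rw [← map_mul]
    rcases eq_or_ne ε δ with rfl | hne
    · exact same κ i j hi hj ε h1 h2 h3 h4
    · obtain rfl : δ = -ε := by
        rcases Int.units_eq_one_or ε with rfl | rfl <;>
          rcases Int.units_eq_one_or δ with rfl | rfl <;> simp_all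
      -- Opposite exponents reduce to equal ones, since `g^ε` is a combination of `1` and `g^{-ε}`.
      obtain ⟨c, d, hcd⟩ := toH_quad j hj ε
      have := hcd 1 (looping κ i hi (-ε))
      rw [one_mul, one_mul, one_mul, ← crossing_neg] at this
      rw [this]
      refine add_mem (Submodule.smul_mem _ _ ?_)
        (Submodule.smul_mem _ _ (same κ i j hi hj (-ε) h1 h2 h3 h4))
      simpa using PH κ i hi (-ε) 1 h1 h2 (by simpa using one_mem_crossSpan m M)

theorem crossSpan_mul_loopSpan_of_lt (m M : ℕ) :
    crossSpan n (m + 1) M * loopSpan n m m ≤ loopSpan n m m * crossSpan n (m + 1) M := by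
  refine crossSpan_mul_le _ fun j hj ε h3 h4 y hy => ?_
  induction hy using Submodule.span_induction with
  | zero => simp
  | add a b _ _ ha hb => rw [mul_add]; exact add_mem ha hb
  | smul c a _ ha => rw [mul_smul_comm]; exact Submodule.smul_mem _ _ ha
  | mem y hy =>
    obtain ⟨κ, i, hi, δ, h1, h2, rfl⟩ := hy
    rw [← map_mul, ← (looping_comm_crossing κ i j hi hj (.inl (by omega)) δ ε).eq, map_mul]
    exact Submodule.mul_mem_mul (looping_mem κ hi δ h1 h2) (crossing_mem hj ε h3 h4)

/-- Iterates `looping_succ`, in which the crossings and the looping carry the same exponent, so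
inverses need no separate treatment. -/
theorem loopSpan_le_conj (m M : ℕ) :
    loopSpan n m M ≤ crossSpan n m M * loopSpan n m m * crossSpan n m M := by
  refine Submodule.span_le.2 ?_
  rintro _ ⟨κ, i, hi, ε, h1, h2, rfl⟩
  induction i, h1 using Nat.le_induction with
  | base =>
    simpa using Submodule.mul_mem_mul (Submodule.mul_mem_mul (one_mem_crossSpan m M)
      (looping_mem κ hi ε le_rfl le_rfl)) (one_mem_crossSpan m M)
  | succ i h1 ih =>
    have hi' : i < n - 1 := by omega
    have h := Submodule.mul_mem_mul (Submodule.mul_mem_mul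
      (crossing_mem (M := M) hi' ε h1 (by omega)) (ih (by omega) (by omega)))
      (crossing_mem (M := M) hi' ε h1 (by omega))
    rw [← map_mul, ← map_mul, ← looping_succ κ i hi'] at h
    refine (?_ : _ ≤ crossSpan n m M * loopSpan n m m * crossSpan n m M) h
    calc crossSpan n m M * (crossSpan n m M * loopSpan n m m * crossSpan n m M) * crossSpan n m M
        = (crossSpan n m M * crossSpan n m M) * loopSpan n m m *
          (crossSpan n m M * crossSpan n m M) := by simp only [mul_assoc]
      _ ≤ _ := mul_le_mul' (mul_le_mul' (crossSpan_mul_self m M) le_rfl) (crossSpan_mul_self m M)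

/-! ### Exchanging loopings of indices `m + 1` and `m` -/

/-- The span of the products `τ_{m+1}^{ε} 𝒯_{m+1}^{-ε}`. -/
def mixedSpan (n m : ℕ) (hm : m + 1 < n) : Submodule Coeff (H2 n) :=
  Submodule.span Coeff {x | ∃ ε : ℤˣ,
    x = toH n (looping .tau (m + 1) hm ε * looping .T (m + 1) hm (-ε))}

theorem mixedSpan_le (m M : ℕ) (hm : m + 1 < n) (hM : m < M) :
    mixedSpan n m hm ≤ loopSpan n (m + 1) M * loopSpan n (m + 1) M := by
  refine Submodule.span_le.2 ?_
  rintro _ ⟨ε, rfl⟩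
  rw [map_mul]
  exact Submodule.mul_mem_mul (looping_mem _ _ _ le_rfl hM) (looping_mem _ _ _ le_rfl hM)

theorem mul_mem_loopSpan_mul_crossSpan {m M : ℕ} {x y : H2 n} (hx : x ∈ crossSpan n m M)
    (hy : y ∈ loopSpan n m M) : x * y ∈ loopSpan n m M * crossSpan n m M :=
  crossSpan_mul_loopSpan m M (Submodule.mul_mem_mul hx hy)

theorem mul_mem_mul_crossSpan {m M : ℕ} {Q : Submodule Coeff (H2 n)} {x y : H2 n}
    (hx : x ∈ Q * crossSpan n m M) (hy : y ∈ crossSpan n m M) : x * y ∈ Q * crossSpan n m M :=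
  (mul_assoc Q (crossSpan n m M) (crossSpan n m M)).le.trans
    (mul_le_mul' le_rfl (crossSpan_mul_self m M)) (Submodule.mul_mem_mul hx hy)

theorem looping_exchange_mixed (m : ℕ) (hm : m < n - 1) (ε : ℤˣ) :
    looping .tau m (by omega) ε * crossing m hm ε * looping .T m (by omega) ε * crossing m hm ε =
      crossing m hm ε * looping .T m (by omega) ε * crossing m hm ε *
        (looping .tau m (by omega) ε : B2 n) := by
  have := (looping_comm (κ := .tau) (κ' := .T) (.inr ⟨rfl, rfl⟩) m hm ε ε).eq
  rw [looping_succ .T m hm] at this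
  simpa only [mul_assoc] using this

theorem looping_exchange_self (κ : LoopKind) (m : ℕ) (hm : m < n - 1) (ε : ℤˣ) :
    looping κ m (by omega) ε * crossing m hm ε * looping κ m (by omega) ε * crossing m hm ε =
      crossing m hm ε * looping κ m (by omega) ε * crossing m hm ε *
        (looping κ m (by omega) ε : B2 n) := by
  have := (looping_comm (κ := κ) (κ' := κ) (.inl rfl) m hm ε ε).eq
  rw [looping_succ κ m hm] at this
  simpa only [mul_assoc] using this

theorem looping_mul_mem (m M : ℕ) (hm : m + 1 < n) (hM : m < M) (κ κ' : LoopKind) (ε δ : ℤˣ)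
    (hκ : Compatible κ' κ ∨ ε = δ) :
    toH n (looping κ (m + 1) hm ε * looping κ' m (by omega) δ) ∈
      loopSpan n m m * loopSpan n m M * crossSpan n m M := by
  by_cases hc : Compatible κ' κ
  · rw [← (looping_comm hc m (by omega) δ ε).eq, map_mul]
    simpa using Submodule.mul_mem_mul (Submodule.mul_mem_mul (looping_mem κ' _ δ le_rfl le_rfl)
      (looping_mem κ _ ε (Nat.le_succ m) hM)) (one_mem_crossSpan m M)
  · obtain rfl := hκ.resolve_left hc
    obtain ⟨rfl, rfl⟩ : κ = .tau ∧ κ' = .T := by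
      cases κ <;> cases κ' <;> simp_all [Compatible]
    have hm' : m < n - 1 := by omega
    obtain ⟨c, d, hcd⟩ := toH_sq m hm' ε
    have hr := looping_exchange_mixed m hm' ε
    have hx := looping_succ .T m hm' ε
    have hy := looping_succ .tau m hm' ε
    have ht := crossing_inv_mem hm' ε le_rfl hM
    have hlx := fun i hi h1 h2 => looping_mem (n := n) (m := m) (M := M) (i := i) .T hi ε h1 h2
    have hly := fun i hi h1 h2 => looping_mem (n := n) (m := m) (M := M) (i := i) .tau hi ε h1 h2
    have ex := looping_mem (n := n) (m := m) (M := m) .T (by omega) ε le_rfl le_rfl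
    have ey := looping_mem (n := n) (m := m) (M := m) .tau (by omega) ε le_rfl le_rfl
    have h1 := Submodule.mul_mem_mul (Submodule.mul_mem_mul ey (hlx (m + 1) hm (by omega) hM)) ht
    have h2 := Submodule.mul_mem_mul (Submodule.mul_mem_mul ex (hly (m + 1) hm (by omega) hM))
      (mul_mem_crossSpan ht ht)
    simp only [← map_mul] at h1 h2
    rw [hx] at h1
    rw [hy] at h2 ⊢
    generalize looping .T m _ ε = x at *
    generalize looping .tau m _ ε = y at *
    generalize crossing m hm' ε = t at *
    -- The exchange relation `hr` produces a square `t * t`; after reducing it, `e1` and `e2`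
    -- rewrite the two resulting words with the index `m` letter first.
    have e0 : t * y * t * x = 1 * t * t * (x * t * y * t⁻¹) := by
      calc t * y * t * x = t * (y * t * x * t) * t⁻¹ := by group
        _ = _ := by rw [hr]; group
    have e1 : 1 * t * (x * t * y * t⁻¹) = y * (t * x * t) * t⁻¹ := by
      calc 1 * t * (x * t * y * t⁻¹) = (t * x * t * y) * t⁻¹ := by group
        _ = _ := by rw [← hr]; group
    have e2 : 1 * (x * t * y * t⁻¹) = x * (t * y * t) * (t⁻¹ * t⁻¹) := by group
    rw [e0, hcd, e1, e2]
    exact add_mem (Submodule.smul_mem _ _ h1) (Submodule.smul_mem _ _ h2)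

theorem loopSpan_exchange (m M : ℕ) (hm : m + 1 < n) (hM : m < M) :
    loopSpan n (m + 1) (m + 1) * loopSpan n m m ≤
      loopSpan n m m * loopSpan n m M * crossSpan n m M ⊔ mixedSpan n m hm * crossSpan n m M := by
  rw [loopSpan, loopSpan, Submodule.span_mul_span]
  refine Submodule.span_le.2 ?_
  rintro _ ⟨_, ⟨κ, i, hi, ε, h1, h2, rfl⟩, _, ⟨κ', i', hi', δ, h1', h2', rfl⟩, rfl⟩
  obtain rfl : i = m + 1 := by omega
  obtain rfl : i' = m := by omega
  dsimp only
  rw [← map_mul]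
  by_cases hκ : Compatible κ' κ ∨ ε = δ
  · exact Submodule.mem_sup_left (looping_mul_mem _ M hm hM κ κ' ε δ hκ)
  push Not at hκ
  obtain ⟨hc, hne⟩ := hκ
  obtain rfl : δ = -ε := by
    rcases Int.units_eq_one_or ε with rfl | rfl <;>
      rcases Int.units_eq_one_or δ with rfl | rfl <;> simp_all
  obtain ⟨rfl, rfl⟩ : κ = .tau ∧ κ' = .T := by
    cases κ <;> cases κ' <;> simp_all [Compatible]
  have hm' : i' < n - 1 := by omega
  obtain ⟨c, d, hcd⟩ := toH_sq i' hm' ε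
  have hr := looping_exchange_mixed i' hm' ε
  have hx := looping_succ .T i' hm' ε
  have hy := looping_succ .tau i' hm' ε
  have ht := crossing_mem hm' ε le_rfl hM
  have hti := crossing_inv_mem hm' ε le_rfl hM
  have h1 : toH n (looping .tau (i' + 1) hm ε * looping .T (i' + 1) hm (-ε)) *
      toH n (crossing i' hm' ε) ∈ mixedSpan n i' hm * crossSpan n i' M :=
    Submodule.mul_mem_mul (Submodule.subset_span ⟨ε, rfl⟩) ht
  have h2 := Submodule.mul_mem_mul
    (looping_mem (m := i') (M := i') .T hi' (-ε) le_rfl le_rfl)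
    (mul_mem_loopSpan_mul_crossSpan (mul_mem_crossSpan hti hti)
      (looping_mem .tau hm ε (Nat.le_succ i') hM))
  rw [← mul_assoc] at h2
  simp only [← map_mul] at h1 h2
  rw [looping_neg] at h1 h2 ⊢
  rw [hx, hy] at h1
  rw [hy] at h2 ⊢
  generalize looping .T i' _ ε = x at *
  generalize looping .tau i' _ ε = y at *
  generalize crossing i' hm' ε = t at *
  -- Inserting `t * t⁻¹` creates a square. Its linear term is the obstruction `e1`; its constant
  -- term `e2` starts with `x⁻¹`, of index `m`.
  have e0 : t * y * t * x⁻¹ = (t * y) * t * t * (t⁻¹ * x⁻¹) := by group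
  have e1 : (t * y) * t * (t⁻¹ * x⁻¹) = (t * y * t) * (t * x * t)⁻¹ * t := by group
  have e2 : (t * y) * (t⁻¹ * x⁻¹) = x⁻¹ * (t⁻¹ * t⁻¹ * (t * y * t)) := by
    calc (t * y) * (t⁻¹ * x⁻¹) = x⁻¹ * t⁻¹ * (t * x * t * y) * (t⁻¹ * x⁻¹) := by group
      _ = _ := by rw [← hr]; group
  rw [e0, hcd, e1, e2]
  exact add_mem (Submodule.mem_sup_right (Submodule.smul_mem _ _ h1))
    (Submodule.mem_sup_left (Submodule.smul_mem _ _ h2))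

theorem mixedSpan_mul_le (m M : ℕ) (hm : m + 1 < n) (hM : m < M) :
    mixedSpan n m hm * loopSpan n m m ≤
      loopSpan n m m * loopSpan n m M * loopSpan n m M * crossSpan n m M := by
  have hm' : m < n - 1 := by omega
  rw [mixedSpan]
  nth_rw 1 [loopSpan]
  rw [Submodule.span_mul_span]
  refine Submodule.span_le.2 ?_
  rintro _ ⟨_, ⟨ε, rfl⟩, _, ⟨κ, i, hi, δ, h1, h2, rfl⟩, rfl⟩
  obtain rfl : i = m := by omega
  dsimp only
  rw [← map_mul]
  -- In this case `𝒯_{m+1}` commutes with the index `m` letter, and `looping_mul_mem` then moves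
  -- that letter past `τ_{m+1}` without obstruction.
  by_cases hκ : κ = .tau ∨ δ = ε
  · have hc : Compatible κ .T := by cases κ <;> simp [Compatible]
    have h3 : looping .tau (i + 1) hm ε * looping .T (i + 1) hm (-ε) * looping κ i hi δ =
        looping .tau (i + 1) hm ε * looping κ i hi δ * looping .T (i + 1) hm (-ε) := by
      rw [mul_assoc, ← (looping_comm hc i hm' δ (-ε)).eq, mul_assoc]
    have h4 := Submodule.mul_mem_mul (looping_mul_mem i M hm hM .tau κ ε δ
      (hκ.imp (fun h => .inl h) Eq.symm)) (looping_mem .T hm (-ε) (Nat.le_succ i) hM)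
    rw [h3, map_mul]
    refine (?_ : _ ≤ loopSpan n i i * loopSpan n i M * loopSpan n i M * crossSpan n i M) h4
    rw [mul_assoc _ _ (loopSpan n i M), mul_assoc _ _ (crossSpan n i M)]
    exact mul_le_mul' le_rfl (crossSpan_mul_loopSpan i M)
  · push Not at hκ
    obtain ⟨hk, hne⟩ := hκ
    obtain rfl : δ = -ε := by
      rcases Int.units_eq_one_or ε with rfl | rfl <;>
        rcases Int.units_eq_one_or δ with rfl | rfl <;> simp_all
    obtain rfl : κ = .T := by cases κ <;> simp_all
    have hr := looping_exchange_mixed i hm' ε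
    have hs := looping_exchange_self .T i hm' ε
    have hx := looping_succ .T i hm' ε
    have hy := looping_succ .tau i hm' ε
    have ht := crossing_mem hm' ε le_rfl hM
    have hti := crossing_inv_mem hm' ε le_rfl hM
    have h2 : toH n ((crossing i hm' ε)⁻¹ * (crossing i hm' ε)⁻¹ * looping .tau (i + 1) hm ε *
        looping .T (i + 1) hm (-ε) * (crossing i hm' ε * crossing i hm' ε)) ∈
        loopSpan n i M * (loopSpan n i M * crossSpan n i M) := by
      simp only [map_mul]
      rw [← mul_assoc (loopSpan n i M)]
      refine mul_mem_mul_crossSpan ?_ (mul_mem_crossSpan ht ht)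
      have h := Submodule.mul_mem_mul (mul_mem_loopSpan_mul_crossSpan (mul_mem_crossSpan hti hti)
        (looping_mem .tau hm ε (Nat.le_succ i) hM)) (looping_mem .T hm (-ε) (Nat.le_succ i) hM)
      refine (?_ : _ ≤ loopSpan n i M * loopSpan n i M * crossSpan n i M) h
      rw [mul_assoc, mul_assoc]
      exact mul_le_mul' le_rfl (crossSpan_mul_loopSpan i M)
    have h3 := Submodule.mul_mem_mul
      (looping_mem (m := i) (M := i) .T hi (-ε) le_rfl le_rfl) h2
    rw [← map_mul, ← mul_assoc (loopSpan n i i), ← mul_assoc (loopSpan n i i * _)] at h3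
    simp only [looping_neg] at h3 ⊢
    rw [hx, hy] at h3 ⊢
    generalize looping .T i _ ε = x at *
    generalize looping .tau i _ ε = y at *
    generalize crossing i hm' ε = t at *
    -- An identity in the braid group, with no quadratic relation and so no new obstruction: `t`
    -- commutes with `x * t * x * t`, and `y` with `t * x * t`.
    have e : t * y * t * (t * x * t)⁻¹ * x⁻¹ =
        x⁻¹ * (t⁻¹ * t⁻¹ * (t * y * t) * (t * x * t)⁻¹ * (t * t)) := by
      have c1 : t * (t * x * t)⁻¹ * x⁻¹ = (t * x * t)⁻¹ * x⁻¹ * t := by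
        calc t * (t * x * t)⁻¹ * x⁻¹ = t * (x * t * x * t)⁻¹ := by group
          _ = (t * x * t * x)⁻¹ * t := by group
          _ = (x * t * x * t)⁻¹ * t := by rw [hs]
          _ = _ := by group
      have c2 : y * (t * x * t)⁻¹ = (t * x * t)⁻¹ * y := by
        calc y * (t * x * t)⁻¹ = (t * x * t)⁻¹ * (t * x * t * y) * (t * x * t)⁻¹ := by group
          _ = _ := by rw [← hr]; group
      calc t * y * t * (t * x * t)⁻¹ * x⁻¹ = t * y * (t * (t * x * t)⁻¹ * x⁻¹) := by group
        _ = t * (y * (t * x * t)⁻¹) * x⁻¹ * t := by rw [c1]; group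
        _ = _ := by rw [c2]; group
    rw [e]
    exact h3

/-! ### Ordering words of loopings -/

theorem Crossing.toBraid_eq (c : Crossing n) :
    c.toBraid = crossing c.idx c.idx.isLt c.exp := rfl

theorem loopWord_cons (l : Looping n) (w : List (Looping n)) :
    loopWord (l :: w) = toH n l.toBraid * loopWord w := by simp [loopWord]

theorem loopSpan_mul_orderedTerms (k : ℕ) (m M : Fin n) (hm : m ≤ M) :
    loopSpan n m m * Submodule.span Coeff (orderedTerms k m M) ≤
      Submodule.span Coeff (orderedTerms (k + 1) m M) := by
  rw [loopSpan, Submodule.span_mul_span]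
  refine Submodule.span_mono ?_
  rintro _ ⟨_, ⟨κ, i, hi, ε, h1, h2, rfl⟩, _, ⟨w, G, hk, hw, hs, hG, rfl⟩, rfl⟩
  obtain rfl : m = ⟨i, hi⟩ := Fin.ext (by simpa using le_antisymm h1 h2)
  refine ⟨⟨κ, ⟨i, hi⟩, ε⟩ :: w, G, by simp [hk], ?_, ?_, hG, ?_⟩
  · intro l hl
    rcases List.mem_cons.1 hl with rfl | hl
    exacts [⟨le_rfl, hm⟩, hw l hl]
  · exact List.pairwise_cons.2 ⟨fun l hl => (hw l hl).1, hs⟩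
  · rw [loopWord_cons, mul_assoc]; rfl

theorem orderedTerms_mul_crossSpan (k : ℕ) (m m' M : Fin n) (h : m ≤ m') :
    Submodule.span Coeff (orderedTerms k m' M) * crossSpan n m M ≤
      Submodule.span Coeff (orderedTerms k m M) := by
  rw [crossSpan, Submodule.span_mul_span]
  refine Submodule.span_mono ?_
  rintro _ ⟨_, ⟨w, G, hk, hw, hs, hG, rfl⟩, _, ⟨G', hG', rfl⟩, rfl⟩
  refine ⟨w, G ++ G', hk, fun l hl => ⟨h.trans (hw l hl).1, (hw l hl).2⟩, hs, ?_, ?_⟩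
  · intro c hc
    rcases List.mem_append.1 hc with hc | hc
    exacts [⟨(show (m : ℕ) ≤ m' from h).trans (hG c hc).1, (hG c hc).2⟩, hG' c hc]
  · simp [crossingWord, mul_assoc]

theorem crossSpan_le_orderedTerms (m M : Fin n) :
    crossSpan n m M ≤ Submodule.span Coeff (orderedTerms 0 m M) := by
  refine Submodule.span_mono ?_
  rintro _ ⟨G, hG, rfl⟩
  exact ⟨[], G, rfl, by simp, by simp, hG, by simp [loopWord]⟩

/-- The span of the words in which all loopings of index `m` come first. -/
def leadingSpan (n m M : ℕ) : ℕ → Submodule Coeff (H2 n)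
  | 0 => crossSpan n m M
  | k + 1 => loopSpan n m m * leadingSpan n m M k ⊔ loopSpan n (m + 1) M ^ (k + 1) * crossSpan n m M

theorem loopSpan_pow_mul_le_leadingSpan (m M : ℕ) (hm : m < M) (hM : M < n) (k : ℕ) :
    loopSpan n m M ^ k * crossSpan n m M ≤ leadingSpan n m M k :=
  sortedWords_absorb (loopSpan n m m) (loopSpan n (m + 1) M) (loopSpan n m M)
    (crossSpan n (m + 1) M) (crossSpan n m M) (loopSpan n (m + 1) (m + 1)) (mixedSpan n m (by omega))
    (leadingSpan n m M) rfl (fun _ => rfl) (loopSpan_eq_sup hm.le) (crossSpan_mul_self m M)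
    (crossSpan_mono (Nat.le_succ m)) (crossSpan_mul_loopSpan m M)
    (crossSpan_mul_loopSpan (m + 1) M) (crossSpan_mul_loopSpan_of_lt m M)
    (loopSpan_le_conj (m + 1) M) (loopSpan_mono le_rfl hm)
    (loopSpan_exchange m M (by omega) hm) (mixedSpan_le m M (by omega) hm)
    (mixedSpan_mul_le m M (by omega) hm) k

/-- Words of `k` loopings with indices in `[m, M]` can be ordered in the mixed Hecke algebra. -/
theorem loopSpan_pow_mul_le_orderedTerms (M : Fin n) (d : ℕ) :
    ∀ (m : Fin n), (m : ℕ) + d = M → ∀ k : ℕ,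
      loopSpan n m M ^ k * crossSpan n m M ≤ Submodule.span Coeff (orderedTerms k m M) := by
  induction d with
  | zero =>
    intro m hm k
    obtain rfl : m = M := Fin.ext (by simpa using hm)
    induction k with
    | zero => simpa using crossSpan_le_orderedTerms m m
    | succ k ih =>
      rw [pow_succ', mul_assoc]
      exact (mul_le_mul' le_rfl ih).trans (loopSpan_mul_orderedTerms k m m le_rfl)
  | succ d ih =>
    intro m hm k
    have hmM : (m : ℕ) < M := by omega
    refine (loopSpan_pow_mul_le_leadingSpan m M hmM M.isLt k).trans ?_
    induction k with
    | zero => exact crossSpan_le_orderedTerms m M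
    | succ k ihk =>
      refine sup_le ((mul_le_mul' le_rfl ihk).trans
        (loopSpan_mul_orderedTerms k m M hmM.le)) ?_
      have hm' : (m : ℕ) + 1 < n := by omega
      have h := ih ⟨m + 1, hm'⟩ (by simp; omega) (k + 1)
      refine le_trans ?_ (orderedTerms_mul_crossSpan (k + 1) m ⟨m + 1, hm'⟩ M
        (Nat.le_succ (m : ℕ)))
      refine mul_le_mul' (le_trans ?_ h) le_rfl
      -- The hypothesis for `[m+1, M]` carries its own crossing factor, supplied here by `1`; the
      -- crossings from `[m, M-1]` are appended afterwards.
      exact le_mul_of_one_le_right' (one_le_crossSpan _ _)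

theorem loopWord_mem (m M : ℕ) (w : List (Looping n))
    (hw : ∀ l ∈ w, m ≤ (l.idx : ℕ) ∧ (l.idx : ℕ) ≤ M) :
    loopWord w ∈ loopSpan n m M ^ w.length := by
  induction w with
  | nil => simpa [loopWord] using Submodule.one_le.1 (le_refl (1 : Submodule Coeff (H2 n)))
  | cons l w ih =>
    rw [loopWord_cons, List.length_cons, pow_succ']
    have hl := hw l List.mem_cons_self
    exact Submodule.mul_mem_mul (looping_mem _ _ _ hl.1 hl.2)
      (ih fun l hl => hw l (List.mem_cons_of_mem _ hl))

theorem loopWord_mem_orderedTerms (w : List (Looping n)) (m M : Fin n) (hmM : m ≤ M)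
    (hw : ∀ l ∈ w, m ≤ l.idx ∧ l.idx ≤ M) :
    loopWord w ∈ Submodule.span Coeff (orderedTerms w.length m M) := by
  have hle : (m : ℕ) ≤ M := hmM
  refine loopSpan_pow_mul_le_orderedTerms M (M - m) m (by omega) w.length ?_
  simpa using Submodule.mul_mem_mul (loopWord_mem m M w hw) (one_mem_crossSpan (n := n) m M)

/-! ### The spanning set `Λ_n` -/

/-- The span of the products of the braiding generators `g_i`. -/
def positiveSpan (n : ℕ) : Submodule Coeff (H2 n) :=
  Submodule.span Coeff {x | ∃ G : List (Fin (n - 1)), x = (G.map g).prod}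

theorem crossingWord_mem_positiveSpan (G : List (Crossing n)) :
    crossingWord G ∈ positiveSpan n := by
  have hmul : positiveSpan n * positiveSpan n ≤ positiveSpan n := by
    rw [positiveSpan, Submodule.span_mul_span]
    refine Submodule.span_mono ?_
    rintro _ ⟨_, ⟨G, rfl⟩, _, ⟨G', rfl⟩, rfl⟩
    exact ⟨G ++ G', by simp⟩
  have hone : (1 : H2 n) ∈ positiveSpan n := Submodule.subset_span ⟨[], by simp⟩
  have hpos : ∀ (i : ℕ) (hi : i < n - 1), toH n (crossing i hi 1) ∈ positiveSpan n :=
    fun i hi => Submodule.subset_span ⟨[⟨i, hi⟩], by simp [g, crossing]⟩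
  induction G with
  | nil => simpa [crossingWord] using hone
  | cons c G ih =>
    have : crossingWord (c :: G) = toH n c.toBraid * crossingWord G := by simp [crossingWord]
    rw [this]
    refine hmul (Submodule.mul_mem_mul ?_ ih)
    rw [Crossing.toBraid_eq]
    rcases Int.units_eq_one_or c.exp with h | h <;> rw [h]
    · exact hpos _ _
    · obtain ⟨a, b, hab⟩ := toH_quad c.idx c.idx.isLt (-1)
      have := hab 1 1
      rw [one_mul, mul_one, one_mul, mul_one, map_one, ← crossing_neg, neg_neg] at this
      rw [this]
      exact add_mem (Submodule.smul_mem _ _ hone) (Submodule.smul_mem _ _ (hpos _ _))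

theorem filter_le_of_sorted (w : List (Looping n))
    (hs : w.Pairwise fun l l' => l.idx ≤ l'.idx) (N : ℕ) :
    w.filter (fun l => (l.idx : ℕ) ≤ N) =
      w.filter (fun l => (l.idx : ℕ) < N) ++ w.filter (fun l => (l.idx : ℕ) = N) := by
  induction w with
  | nil => simp
  | cons l w ih =>
    rw [List.pairwise_cons] at hs
    rcases lt_trichotomy (l.idx : ℕ) N with h | h | h
    · simp [h, h.ne, h.le, ih hs.2]
    · have h0 : w.filter (fun l => (l.idx : ℕ) < N) = [] := by
        rw [List.filter_eq_nil_iff]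
        intro a ha
        have : (l.idx : ℕ) ≤ a.idx := hs.1 a ha
        simp; omega
      simp [h, ih hs.2, h0]
    · have h1 : ¬ (l.idx : ℕ) ≤ N := by omega
      simp [h1, h.ne', h.not_gt, ih hs.2]

/-- Provides the blocks `Π_i`: a word sorted by index is the concatenation of its sublists of
constant index. -/
theorem prod_loopWord_filter (w : List (Looping n))
    (hs : w.Pairwise fun l l' => l.idx ≤ l'.idx) (N : ℕ) :
    (List.ofFn fun i : Fin N => loopWord (w.filter fun l => (l.idx : ℕ) = i)).prod =
      loopWord (w.filter fun l => (l.idx : ℕ) < N) := by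
  induction N with
  | zero => simp [loopWord]
  | succ N ih =>
    rw [List.ofFn_succ_last, List.prod_append]
    simp only [Nat.lt_succ_iff, filter_le_of_sorted w hs]
    simp only [Fin.val_castSucc, ih, Fin.val_last, List.prod_singleton]
    simp [loopWord]

theorem orderedTerms_subset_span_Lambda (k : ℕ) (m M : Fin n) :
    orderedTerms k m M ⊆ Submodule.span Coeff (Lambda n) := by
  rintro _ ⟨w, G, -, -, hs, -, rfl⟩
  have hw : loopWord w =
      (List.ofFn fun i : Fin n => loopWord (w.filter fun l => (l.idx : ℕ) = i)).prod := by
    rw [prod_loopWord_filter w hs, List.filter_eq_self.2 (by simp)]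
  have h := Submodule.mul_mem_mul (Submodule.mem_span_singleton_self (R := Coeff) (loopWord w))
    (crossingWord_mem_positiveSpan G)
  rw [positiveSpan, Submodule.span_mul_span] at h
  refine Submodule.span_mono ?_ h
  rintro _ ⟨_, rfl, _, ⟨G', rfl⟩, rfl⟩
  refine ⟨fun i => w.filter fun l => (l.idx : ℕ) = i, G', ?_, ?_⟩
  · intro i l hl
    exact Fin.ext (by simpa using (List.mem_filter.1 hl).2)
  · dsimp only
    rw [hw]

/-- The supremum contains `1` and is stable under left multiplication by each generator and its
inverse, since `𝒯` and `τ` are loopings of lowest index and crossings move past loopings. -/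
theorem toH_mem_iSup (b : B2 n) (hn : 1 ≤ n) :
    toH n b ∈ ⨆ k, loopSpan n 0 (n - 1) ^ k * crossSpan n 0 (n - 1) := by
  set U : Submodule Coeff (H2 n) := ⨆ k, loopSpan n 0 (n - 1) ^ k * crossSpan n 0 (n - 1) with hU
  have hP : loopSpan n 0 (n - 1) * U ≤ U := by
    rw [hU, Submodule.mul_iSup]
    refine iSup_le fun k => ?_
    rw [← mul_assoc, ← pow_succ']
    exact le_iSup (fun k => loopSpan n 0 (n - 1) ^ k * crossSpan n 0 (n - 1)) (k + 1)
  have hH : crossSpan n 0 (n - 1) * U ≤ U := by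
    rw [hU, Submodule.mul_iSup]
    refine iSup_le fun k => ?_
    refine le_trans ?_ (le_iSup (fun k => loopSpan n 0 (n - 1) ^ k * crossSpan n 0 (n - 1)) k)
    induction k with
    | zero => simpa using crossSpan_mul_self 0 (n - 1)
    | succ k ih =>
      rw [pow_succ', mul_assoc, ← mul_assoc]
      refine (mul_le_mul' (crossSpan_mul_loopSpan 0 (n - 1)) le_rfl).trans ?_
      rw [mul_assoc]
      exact mul_le_mul' le_rfl ih
  have one_mem : (1 : H2 n) ∈ U := by
    refine Submodule.mem_iSup_of_mem 0 ?_
    simpa using one_mem_crossSpan 0 (n - 1)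
  have key : ∀ x ∈ U, toH n b * x ∈ U := by
    obtain ⟨z, rfl⟩ := PresentedGroup.mk_surjective _ b
    have letter : ∀ (s : Gen n) (ε : ℤˣ), ∀ x ∈ U,
        toH n ((PresentedGroup.of s : B2 n) ^ (ε : ℤ)) * x ∈ U := by
      rintro (κ | i) ε x hx
      · exact hP (Submodule.mul_mem_mul
          (looping_mem κ (i := 0) (by omega) ε le_rfl (Nat.zero_le _)) hx)
      · exact hH (Submodule.mul_mem_mul (crossing_mem i.isLt ε (Nat.zero_le _) i.isLt) hx)
    induction z using FreeGroup.induction_on with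
    | C1 => simp
    | of s => simpa [PresentedGroup.of] using letter s 1
    | inv_of s _ => simpa [PresentedGroup.of] using letter s (-1)
    | mul y z hy hz =>
      intro x hx
      rw [map_mul, map_mul, mul_assoc]
      exact hy _ (hz _ hx)
  simpa using key 1 one_mem

theorem span_Lambda_eq_top (hn : 1 ≤ n) : Submodule.span Coeff (Lambda n) = ⊤ := by
  have hg : ∀ b : B2 n, toH n b ∈ Submodule.span Coeff (Lambda n) := by
    intro b
    refine (iSup_le fun k => ?_ : _ ≤ Submodule.span Coeff (Lambda n)) (toH_mem_iSup b hn)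
    refine (loopSpan_pow_mul_le_orderedTerms ⟨n - 1, by omega⟩ (n - 1) ⟨0, hn⟩ (by simp) k).trans ?_
    exact Submodule.span_le.2 (orderedTerms_subset_span_Lambda _ _ _)
  refine eq_top_iff.2 fun x _ => ?_
  obtain ⟨y, rfl⟩ := RingQuot.mkAlgHom_surjective Coeff (QuadRel n) x
  induction y using MonoidAlgebra.induction_on with
  | of b => exact hg b
  | add y z hy hz => rw [map_add]; exact add_mem (hy trivial) (hz trivial)
  | smul c y hy => rw [map_smul]; exact Submodule.smul_mem _ _ (hy trivial)

end MixedBraid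
end

theorem theorem1 (n : ℕ) (hn : 1 ≤ n) :
    (∀ (w : List (MixedBraid.Looping n)) (m M : Fin n),
      IsLeast {i | ∃ l ∈ w, l.idx = i} m →
      IsGreatest {i | ∃ l ∈ w, l.idx = i} M →
      MixedBraid.loopWord w ∈
        Submodule.span MixedBraid.Coeff (MixedBraid.orderedTerms w.length m M)) ∧
    Submodule.span MixedBraid.Coeff (MixedBraid.Lambda n) = ⊤ := by
  refine ⟨fun w m M hm hM => ?_, MixedBraid.span_Lambda_eq_top hn⟩
  -- `m ≤ M` because `M` is attained as an index in `w`.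
  exact MixedBraid.loopWord_mem_orderedTerms w m M (hm.2 hM.1)
    fun l hl => ⟨hm.2 ⟨l, hl, rfl⟩, hM.2 ⟨l, hl, rfl⟩⟩
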